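/- Let $n\ge 2$, let $\mathfrak g$ and $V$ be vector spaces over a field of characteristic $0$, let $\mu=[-,\dots,-]_{\mathfrak g}:\wedge^n\mathfrak g\to\mathfrak g$ be an $n$-Lie algebra structure on $\mathfrak g$, and let $\rho:\wedge^{n-1}\mathfrak g\to\mathfrak{gl}(V)$ be a representation of it. Let $T:V\to\mathfrak g$ be a relative Rota–Baxter operator, i.e. a linear map with $$[Tv_1,\dots,Tv_n]_{\mathfrak g}=\sum_{i=1}^n(-1)^{n-i}\,T\big(\rho(Tv_1,\dots,\widehat{Tv_i},\dots,Tv_n)v_i\big)\qquad(v_1,\dots,v_n\in V).$$ *The coboundary $d$.* Put $$[u_1,\dots,u_n]_T=\sum_{i=1}^n(-1)^{n-i}\rho(Tu_1,\dots,\widehat{Tu_i},\dots,Tu_n)u_i,$$ $$\rho_T(u_1,\dots,u_{n-1})x=[Tu_1,\dots,Tu_{n-1},x]_{\mathfrak g}-\sum_{i=1}^{n-1}(-1)^{n-i}\,T\rho(Tu_1,\dots,\widehat{Tu_i},\dots,Tu_{n-1},x)u_i .$$ For $m\ge1$ let $C^m_T(V;\mathfrak g)=\operatorname{Hom}(\otimes^{m-1}(\wedge^{n-1}V)\wedge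 V,\mathfrak g)$ be the space of maps that are linear in $(m-1)(n-1)+1$ vectors, alternating in each of the $m-1$ blocks of $n-1$ vectors, and alternating in the last block together with the final vector. For $f\in C^m_T(V;\mathfrak g)$, $\mathfrak U_j=u_j^1\wedge\dots\wedge u_j^{n-1}$ and $u\in V$, the $n$-Lie algebra coboundary of $(V,[-,\dots,-]_T)$ with coefficients in $(\mathfrak g;\rho_T)$ is $$\begin{aligned}(df)(\mathfrak U_1,\dots,\mathfrak U_m,u)={}&\sum_{1\le j<k\le m}(-1)^jf(\mathfrak U_1,\dots,\widehat{\mathfrak U_j},\dots,\mathfrak U_j\circ\mathfrak U_k,\dots,\mathfrak U_m,u)+\sum_{j=1}^m(-1)^jf(\mathfrak U_1,\dots,\widehat{\mathfrak U_j},\dots,\mathfrak U_m,[\mathfrak U_j,u]_T)\\&+\sum_{j=1}^m(-1)^{j+1}\rho_T(\mathfrak U_j)f(\mathfrak U_1,\dots,\widehat{\mathfrak U_j},\dots,\mathfrak U_m,u)\\&+\sum_{i=1}^{n-1}(-1)^{n+m-i+1}\rho_T(u_m^1,\dots,\widehat{u_m^i},\dots,u_m^{n-1},u)f(\mathfrak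 U_1,\dots,\mathfrak U_{m-1},u_m^i),\end{aligned}$$ where $\mathfrak U_j\circ\mathfrak U_k=\sum_{i=1}^{n-1}u_k^1\wedge\dots\wedge[\mathfrak U_j,u_k^i]_T\wedge\dots\wedge u_k^{n-1}$ stands in the place of $\mathfrak U_k$. *The differential $l_1^T$.* For a vector space $W$ and $P,Q$ in $\operatorname{Hom}(\otimes^p(\wedge^{n-1}W)\wedge W,W)$ and $\operatorname{Hom}(\otimes^q(\wedge^{n-1}W)\wedge W,W)$ (of degrees $p$ and $q$) let $[P,Q]_{\rm nLie}=P\circ Q-(-1)^{pq}Q\circ P$, where, for $\mathfrak X_j=x_j^1\wedge\dots\wedge x_j^{n-1}\in\wedge^{n-1}W$ and $x\in W$, and with $S(a,b)$ the set of $(a,b)$-shuffles, $$\begin{aligned}(P\circ Q)&(\mathfrak X_1,\dots,\mathfrak X_{p+q},x)\\={}&\sum_{k=1}^p(-1)^{(k-1)q}\sum_{\sigma\in S(k-1,q)}(-1)^\sigma\sum_{i=1}^{n-1}P\big(\mathfrak X_{\sigma(1)},\dots,\mathfrak X_{\sigma(k-1)},\,x_{k+q}^1\wedge\dots\wedge Q(\mathfrak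 X_{\sigma(k)},\dots,\mathfrak X_{\sigma(k+q-1)},x_{k+q}^i)\wedge\dots\wedge x_{k+q}^{n-1},\,\mathfrak X_{k+q+1},\dots,\mathfrak X_{p+q},x\big)\\&+(-1)^{pq}\sum_{\sigma\in S(p,q)}(-1)^\sigma P\big(\mathfrak X_{\sigma(1)},\dots,\mathfrak X_{\sigma(p)},Q(\mathfrak X_{\sigma(p+1)},\dots,\mathfrak X_{\sigma(p+q)},x)\big).\end{aligned}$$ Take $W=\mathfrak g\oplus V$, let $\mu+\rho$ (of degree $1$) be the semidirect product bracket $$(x_1+u_1,\dots,x_n+u_n)\mapsto[x_1,\dots,x_n]_{\mathfrak g}+\sum_{i=1}^n(-1)^{n-i}\rho(x_1,\dots,\widehat{x_i},\dots,x_n)u_i,$$ and regard every $P\in\operatorname{Hom}(\otimes^p(\wedge^{n-1}V)\wedge V,\mathfrak g)$ as an element of degree $p$ for $W=\mathfrak g\oplus V$ by evaluating it on the $V$-components. With the $n$-ary bracket $\{P_1,\dots,P_n\}=[\cdots[[\mu+\rho,P_1]_{\rm nLie},P_2]_{\rm nLie},\cdots,P_n]_{\rm nLie}$, the differential of the $L_\infty$-algebra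 twisted by $T$ is $$l_1^Tf=\frac1{(n-1)!}\{\underbrace{T,\dots,T}_{n-1},f\}.$$ **Theorem.** For all $m\ge1$ and all $f\in C_T^m(V;\mathfrak g)$, $$df=(-1)^{m-1}\,l_1^Tf .$$ -/

import Mathlib

/-!
Throughout, `r = n - 1`, so that an `n`-ary operation has `r + 1` arguments, an element
`x¹ ∧ ⋯ ∧ xⁿ⁻¹` of `⋀ⁿ⁻¹ W` is given by a family `Fin r → W`, and indices start at `0`. A sign
`(-1)^(n - i)` with `1 ≤ i ≤ n` therefore becomes `(-1)^(r - i)` with `0 ≤ i ≤ r`, and this is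
written `(-1)^(r + i)`.
-/

namespace NLie

open Function

section Structures

variable {K g V : Type*} [Field K] [AddCommGroup g] [Module K g] [AddCommGroup V] [Module K V]
  {r : ℕ}

/-- The Filippov identity: the skew-symmetric `n`-linear bracket `μ` makes `g` an `n`-Lie algebra. -/
def IsNLieBracket (μ : g [⋀^Fin (r + 1)]→ₗ[K] g) : Prop :=
  ∀ (x : Fin r → g) (y : Fin (r + 1) → g),
    μ (Fin.snoc x (μ y)) = ∑ i : Fin (r + 1), μ (update y i (μ (Fin.snoc x (y i))))

/-- `ρ : ⋀ⁿ⁻¹ g → gl(V)` is a representation of the `n`-Lie algebra `(g, μ)` on `V`. In the second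
identity `l` is the last of the `n - 1` positions; the entry of `x` there is overwritten, so that
only `x₁, …, xₙ₋₂` matter. -/
structure IsRepresentation (μ : g [⋀^Fin (r + 1)]→ₗ[K] g)
    (ρ : g [⋀^Fin r]→ₗ[K] Module.End K V) : Prop where
  commutator : ∀ x y : Fin r → g,
    ρ x * ρ y - ρ y * ρ x = ∑ i : Fin r, ρ (update y i (μ (Fin.snoc x (y i))))
  bracket_last : ∀ (x : Fin r → g) (y : Fin (r + 1) → g) (l : Fin r), (l : ℕ) + 1 = r →
    ρ (update x l (μ y)) =
      ∑ i : Fin (r + 1), (-1 : ℤ) ^ (r + (i : ℕ)) • (ρ (i.removeNth y) * ρ (update x l (y i)))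

/-- `T : V → g` is a relative Rota–Baxter operator on the `n`-LieRep pair `(g, μ; ρ)`. -/
def IsRelativeRotaBaxter (μ : g [⋀^Fin (r + 1)]→ₗ[K] g)
    (ρ : g [⋀^Fin r]→ₗ[K] Module.End K V) (T : V →ₗ[K] g) : Prop :=
  ∀ v : Fin (r + 1) → V,
    μ (fun i => T (v i)) = ∑ i : Fin (r + 1),
      (-1 : ℤ) ^ (r + (i : ℕ)) • T (ρ (i.removeNth fun j => T (v j)) (v i))

/-- The `n`-ary bracket `[u₁, …, uₙ]_T` on `V`. -/
def bracketT (ρ : g [⋀^Fin r]→ₗ[K] Module.End K V) (T : V →ₗ[K] g) (u : Fin (r + 1) → V) : V :=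
  ∑ i : Fin (r + 1), (-1 : ℤ) ^ (r + (i : ℕ)) • ρ (i.removeNth fun j => T (u j)) (u i)

/-- `ρ_T(u₁, …, uₙ₋₁) x = [Tu₁, …, Tuₙ₋₁, x] - ∑ᵢ (-1)^(n-i) T ρ(Tu₁, …, T̂uᵢ, …, Tuₙ₋₁, x) uᵢ`. -/
def rhoT (μ : g [⋀^Fin (r + 1)]→ₗ[K] g) (ρ : g [⋀^Fin r]→ₗ[K] Module.End K V) (T : V →ₗ[K] g)
    (u : Fin r → V) (x : g) : g :=
  μ (Fin.snoc (fun j => T (u j)) x) - ∑ i : Fin r, (-1 : ℤ) ^ (r + (i : ℕ)) •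
    T (ρ (i.castSucc.removeNth (Fin.snoc (fun j => T (u j)) x : Fin (r + 1) → g)) (u i))

end Structures

section Cochains

/-- Functions of `p` blocks of `n - 1` vectors and one further vector. The cochains, which are the
functions of this kind satisfying `IsCochain` below, are a subspace. -/
abbrev Func (r p : ℕ) (W U : Type*) : Type _ := (Fin p → Fin r → W) → W → U

/-- `f` belongs to `Hom(⊗ᵖ(⋀ⁿ⁻¹ W) ∧ W, U)`: it is linear in each of its `p (n - 1) + 1` arguments,
alternating in each block, and alternating in the last block and the final vector together. -/
structure IsCochain (K : Type*) {W U : Type*} [Field K] [AddCommGroup W] [Module K W]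
    [AddCommGroup U] [Module K U] {r p : ℕ} (f : Func r p W U) : Prop where
  add_block : ∀ (X : Fin p → Fin r → W) (x : W) (a : Fin p) (i : Fin r) (u v : W),
    f (update X a (update (X a) i (u + v))) x =
      f (update X a (update (X a) i u)) x + f (update X a (update (X a) i v)) x
  smul_block : ∀ (X : Fin p → Fin r → W) (x : W) (a : Fin p) (i : Fin r) (c : K) (u : W),
    f (update X a (update (X a) i (c • u))) x = c • f (update X a (update (X a) i u)) x
  add_last : ∀ (X : Fin p → Fin r → W) (u v : W), f X (u + v) = f X u + f X v
  smul_last : ∀ (X : Fin p → Fin r → W) (c : K) (u : W), f X (c • u) = c • f X u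
  alt_block : ∀ (X : Fin p → Fin r → W) (x : W) (a : Fin p) (i j : Fin r),
    i ≠ j → X a i = X a j → f X x = 0
  alt_last : ∀ (X : Fin p → Fin r → W) (x : W) (a : Fin p) (i : Fin r),
    (a : ℕ) + 1 = p → X a i = x → f X x = 0

/-- The space `Hom(⊗ᵖ(⋀ⁿ⁻¹ W) ∧ W, U)`. It is the space `C^(p+1)` of `(p+1)`-cochains of an `n`-Lie
algebra `W` with coefficients in `U`, and, for `U = W`, the component of degree `p` of the graded Lie
algebra controlling `n`-Lie structures on `W`. -/
def cochains (K : Type*) (W U : Type*) [Field K] [AddCommGroup W] [Module K W]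
    [AddCommGroup U] [Module K U] (r p : ℕ) : Submodule K (Func r p W U) where
  carrier := {f | IsCochain K f}
  zero_mem' := by constructor <;> intros <;> simp
  add_mem' := by
    intro f f' hf hf'
    constructor
    · intro X x a i u v
      simp only [Pi.add_apply, hf.add_block, hf'.add_block]
      abel
    · intro X x a i c u
      simp only [Pi.add_apply, hf.smul_block, hf'.smul_block, smul_add]
    · intro X u v
      simp only [Pi.add_apply, hf.add_last, hf'.add_last]
      abel
    · intro X c u
      simp only [Pi.add_apply, hf.smul_last, hf'.smul_last, smul_add]
    · intro X x a i j hij h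
      simp only [Pi.add_apply, hf.alt_block X x a i j hij h, hf'.alt_block X x a i j hij h, add_zero]
    · intro X x a i ha h
      simp only [Pi.add_apply, hf.alt_last X x a i ha h, hf'.alt_last X x a i ha h, add_zero]
  smul_mem' := by
    intro k f hf
    constructor
    · intro X x a i u v
      simp only [Pi.smul_apply, hf.add_block, smul_add]
    · intro X x a i c u
      simp only [Pi.smul_apply, hf.smul_block, smul_comm k c]
    · intro X u v
      simp only [Pi.smul_apply, hf.add_last, smul_add]
    · intro X c u
      simp only [Pi.smul_apply, hf.smul_last, smul_comm k c]
    · intro X x a i j hij h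
      simp only [Pi.smul_apply, hf.alt_block X x a i j hij h, smul_zero]
    · intro X x a i ha h
      simp only [Pi.smul_apply, hf.alt_last X x a i ha h, smul_zero]

/-- The `n`-Lie algebra coboundary operator `C^m → C^(m+1)`, `m = p + 1`, of the `n`-ary bracket `br`
on `W` with coefficients in `U`, where `⋀ⁿ⁻¹ W` acts on `U` by `act`. The sum over `i` in the first
line expands `𝔛ⱼ ∘ 𝔛ₖ = ∑ᵢ xₖ¹ ∧ ⋯ ∧ [𝔛ⱼ, xₖⁱ] ∧ ⋯ ∧ xₖⁿ⁻¹`. -/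
def coboundary {W U : Type*} [AddCommGroup U] {r p : ℕ} (br : (Fin (r + 1) → W) → W)
    (act : (Fin r → W) → U → U) (f : Func r p W U) : Func r (p + 1) W U := fun X x =>
  (∑ j : Fin (p + 1), ∑ k : Fin (p + 1), if j < k then
      (-1 : ℤ) ^ ((j : ℕ) + 1) • ∑ i : Fin r,
        f (j.removeNth (update X k (update (X k) i (br (Fin.snoc (X j) (X k i)))))) x
    else 0)
  + (∑ j : Fin (p + 1), (-1 : ℤ) ^ ((j : ℕ) + 1) • f (j.removeNth X) (br (Fin.snoc (X j) x)))
  + (∑ j : Fin (p + 1), (-1 : ℤ) ^ (j : ℕ) • act (X j) (f (j.removeNth X) x))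
  + ∑ i : Fin r, (-1 : ℤ) ^ (r + p + (i : ℕ)) •
      act (i.castSucc.removeNth (Fin.snoc (X (Fin.last p)) x : Fin (r + 1) → W))
        (f (fun a : Fin p => X a.castSucc) (X (Fin.last p) i))

end Cochains

section GradedBracket

/-- The `(a, b)`-shuffles, acting on the first `a + b` of `N` letters and fixing the other ones. -/
def shuffles (N a b : ℕ) : Finset (Equiv.Perm (Fin N)) :=
  {σ | (∀ i j : Fin N, i < j → (j : ℕ) < a → σ i < σ j) ∧
    (∀ i j : Fin N, a ≤ (i : ℕ) → i < j → (j : ℕ) < a + b → σ i < σ j) ∧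
    (∀ i : Fin N, a + b ≤ (i : ℕ) → σ i = i)}

variable {W : Type*} [AddCommGroup W] {r p q N : ℕ}

/-- The product `P ∘ Q` of degree `N = p + q` of elements of degrees `p` and `q`. In the first sum
the block with index `k` of `P` is `𝔛` at the index `k + q`, with its `i`-th entry replaced by the
value of `Q`. -/
def circ (h : p + q = N) (P : Func r p W W) (Q : Func r q W W) : Func r N W W := fun X x =>
  (∑ k : Fin p, (-1 : ℤ) ^ ((k : ℕ) * q) • ∑ σ ∈ shuffles N k q,
    (Equiv.Perm.sign σ : ℤ) • ∑ i : Fin r,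
      P (fun j : Fin p =>
          if j < k then X (σ ⟨j, by omega⟩)
          else if j = k then
            update (X ⟨(k : ℕ) + q, by omega⟩) i
              (Q (fun l : Fin q => X (σ ⟨(k : ℕ) + l, by omega⟩)) (X ⟨(k : ℕ) + q, by omega⟩ i))
          else X ⟨(j : ℕ) + q, by omega⟩) x)
  + (-1 : ℤ) ^ (p * q) • ∑ σ ∈ shuffles N p q, (Equiv.Perm.sign σ : ℤ) •
      P (fun j : Fin p => X (σ ⟨j, by omega⟩))
        (Q (fun l : Fin q => X (σ ⟨p + (l : ℕ), by omega⟩)) x)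

/-- The graded commutator `[P, Q] = P ∘ Q - (-1)^(pq) Q ∘ P`. -/
def gradedBracket (h : p + q = N) (P : Func r p W W) (Q : Func r q W W) : Func r N W W :=
  circ h P Q - (-1 : ℤ) ^ (p * q) • circ ((add_comm q p).trans h) Q P

end GradedBracket

section Twisted

variable {K g V : Type*} [Field K] [AddCommGroup g] [Module K g] [AddCommGroup V] [Module K V]
  {r : ℕ}

/-- The element `μ + ρ` of degree `1` for the space `g ⊕ V`: the semidirect product bracket. -/
def semidirect (μ : g [⋀^Fin (r + 1)]→ₗ[K] g) (ρ : g [⋀^Fin r]→ₗ[K] Module.End K V) :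
    Func r 1 (g × V) (g × V) := fun X x =>
  let z : Fin (r + 1) → g × V := Fin.snoc (X 0) x
  (μ fun i => (z i).1,
    ∑ i : Fin (r + 1), (-1 : ℤ) ^ (r + (i : ℕ)) • ρ (i.removeNth fun j => (z j).1) (z i).2)

/-- The lift of a function on `V` with values in `g` to one on `g ⊕ V` with values in `g ⊕ V`. It
embeds `C*(V, g)` into the graded Lie algebra of the space `g ⊕ V`. -/
def lift {p : ℕ} (f : Func r p V g) : Func r p (g × V) (g × V) := fun X x =>
  (f (fun a i => (X a i).2) x.2, 0)

/-- The iterated bracket `[⋯[[π, P₁], P₂], ⋯, Pⱼ]`, for `π` of degree `1` and `P₁, …, Pⱼ` homogeneous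
elements of `C*(V, g)`; its degree is `N = 1 + deg P₁ + ⋯ + deg Pⱼ`. -/
def iteratedBracket (π : Func r 1 (g × V) (g × V)) :
    (j : ℕ) → (P : Fin j → Σ p : ℕ, Func r p V g) → (N : ℕ) → 1 + ∑ i, (P i).1 = N →
      Func r N (g × V) (g × V)
  | 0, _, _, h => fun X x => π (fun a => X (Fin.cast (by simpa using h) a)) x
  | j + 1, P, _, h =>
      gradedBracket (by rw [← h, Fin.sum_univ_castSucc, add_assoc])
        (iteratedBracket π j (fun i => P i.castSucc) (1 + ∑ i : Fin j, (P i.castSucc).1) rfl)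
        (lift (P (Fin.last j)).2)

/-- The `n`-ary bracket `{P₁, …, Pₙ} = [⋯[[μ + ρ, P₁], P₂], ⋯, Pₙ]` of the Lie `n`-algebra
`C*(V, g)`, the latter being regarded as a subspace of the graded Lie algebra of `g ⊕ V`. -/
def lieNBracket (μ : g [⋀^Fin (r + 1)]→ₗ[K] g) (ρ : g [⋀^Fin r]→ₗ[K] Module.End K V)
    (P : Fin (r + 1) → Σ p : ℕ, Func r p V g) (N : ℕ) (h : 1 + ∑ i, (P i).1 = N) :
    Func r N (g × V) (g × V) :=
  iteratedBracket (semidirect μ ρ) (r + 1) P N h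

/-- The differential `l₁ᵀ(f) = 1/(n-1)! {T, …, T, f}` of the twisted `L∞`-algebra. -/
def l1T (μ : g [⋀^Fin (r + 1)]→ₗ[K] g) (ρ : g [⋀^Fin r]→ₗ[K] Module.End K V) (T : V →ₗ[K] g)
    {p : ℕ} (f : Func r p V g) : Func r (p + 1) (g × V) (g × V) :=
  (r.factorial : K)⁻¹ • lieNBracket μ ρ
    (Fin.snoc (fun _ : Fin r => (⟨0, fun _ v => T v⟩ : Σ p : ℕ, Func r p V g)) ⟨p, f⟩) (p + 1)
    (by simp [Fin.sum_univ_castSucc, add_comm])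

end Twisted

end NLie

/-! Bracketing an `n`-ary operation `F` on `g ⊕ V` with `T` in degree `0` gives `D F = L F - t ∘ F`,
where `t` is `T` viewed as an endomorphism of `g ⊕ V` and `L` applies `t` to each argument in turn.
Since `t² = 0`, `L^k F` is `k!` times the sum over all `k`-subsets of arguments, post-composition
with `t` commutes with `L`, and the binomial expansion of `D^r` stops after two terms
(`iterate_derive`). For the semidirect bracket, `D^r` is thus `r!` times one operation,
`twistedBracket`, whose `V`-part is `[-, …, -]_T` and whose `g`-part is built from `ρ_T`
(`twistedBracket_apply`).

Hence `l₁ᵀ f` is the graded bracket of `twistedBracket` with `f`: the factor `r!` is invertible in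
characteristic `0` and cancels. With a factor of degree `1` every shuffle moves a single block, so
both compositions become signed sums over one distinguished block (`circ_ofNary_left`,
`circ_ofNary_right`). Up to the global sign `(-1)^p` they are the four sums of the coboundary
(`lift_coboundary_eq`). -/

namespace NLie

open Function Finset

/-! ### Iterated bracketing with a square-zero endomorphism. -/

section SlotSums

variable {ι K W : Type*} [Fintype ι] [DecidableEq ι] [CommRing K] [AddCommGroup W] [Module K W]

/-- The sum of the functions obtained from `F` by applying `t` to one of the arguments. -/
def slotSum (t : W →ₗ[K] W) (F : (ι → W) → W) (z : ι → W) : W :=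
  ∑ i, F (update z i (t (z i)))

/-- The sum of the functions obtained from `F` by applying `t` to `k` of the arguments. -/
def subsetSum (t : W →ₗ[K] W) (F : (ι → W) → W) (k : ℕ) (z : ι → W) : W :=
  ∑ S ∈ powersetCard k univ, F (S.piecewise (fun i => t (z i)) z)

/-- The bijection is `(S, i) ↦ (S ∪ {i}, i)`. -/
theorem sum_powersetCard_sum_compl {M : Type*} [AddCommMonoid M] (k : ℕ) (h : Finset ι → ι → M) :
    ∑ S ∈ powersetCard k univ, ∑ i ∈ Sᶜ, h S i =
      ∑ S ∈ powersetCard (k + 1) univ, ∑ i ∈ S, h (S.erase i) i := by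
  rw [sum_sigma', sum_sigma']
  refine sum_bij' (fun a _ => ⟨insert a.2 a.1, a.2⟩) (fun a _ => ⟨a.1.erase a.2, a.2⟩) ?_ ?_ ?_ ?_ ?_
  · rintro ⟨S, i⟩ hS
    simp only [mem_sigma, mem_powersetCard_univ, mem_compl] at hS ⊢
    exact ⟨by rw [card_insert_of_notMem hS.2, hS.1], mem_insert_self _ _⟩
  · rintro ⟨S, i⟩ hS
    simp only [mem_sigma, mem_powersetCard_univ, mem_compl] at hS ⊢
    exact ⟨by rw [card_erase_of_mem hS.2, hS.1, Nat.add_sub_cancel], notMem_erase _ _⟩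
  · rintro ⟨S, i⟩ hS
    simp only [mem_sigma, mem_compl] at hS
    simp [erase_insert hS.2]
  · rintro ⟨S, i⟩ hS
    simp only [mem_sigma] at hS
    simp [insert_erase hS.2]
  · rintro ⟨S, i⟩ hS
    simp only [mem_sigma, mem_compl] at hS
    simp [erase_insert hS.2]

theorem sum_powersetCard_card_sub_one {M : Type*} [AddCommMonoid M] {k : ℕ}
    (hk : k + 1 = Fintype.card ι) (h : Finset ι → M) :
    ∑ S ∈ powersetCard k univ, h S = ∑ j, h (univ.erase j) := by
  symm
  refine sum_bij (fun j _ => univ.erase j) ?_ ?_ ?_ ?_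
  · intro j _
    rw [mem_powersetCard_univ, card_erase_of_mem (mem_univ j), card_univ, ← hk, Nat.add_sub_cancel]
  · intro i _ j _ hij
    by_contra hne
    have : i ∈ univ.erase i := hij ▸ mem_erase.2 ⟨hne, mem_univ i⟩
    simp at this
  · intro S hS
    rw [mem_powersetCard_univ] at hS
    have hc : Sᶜ.card = 1 := by rw [card_compl, hS, ← hk, Nat.add_sub_cancel_left]
    obtain ⟨j, hj⟩ := card_eq_one.1 hc
    exact ⟨j, mem_univ j, by rw [← compl_singleton, ← hj, compl_compl]⟩
  · intros; rfl

theorem subsetSum_zero (t : W →ₗ[K] W) (F : (ι → W) → W) : subsetSum t F 0 = F := by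
  ext z
  simp [subsetSum]

/-- A second `t` in a slot of `S` gives zero because `t² = 0`. Every other slot enlarges `S`, and
each `(k + 1)`-subset arises once for each of its elements. -/
theorem slotSum_subsetSum {t : W →ₗ[K] W} (ht : ∀ w, t (t w) = 0)
    (F : MultilinearMap K (fun _ : ι => W) W) (k : ℕ) :
    slotSum t (subsetSum t F k) = fun z => (k + 1) • subsetSum t F (k + 1) z := by
  ext z
  have hmem : ∀ S : Finset ι, ∀ i ∈ S, F (S.piecewise (fun j => t (update z i (t (z i)) j))
      (update z i (t (z i)))) = 0 := by
    intro S i hi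
    exact F.map_coord_zero i (by simp [hi, ht])
  have hnot : ∀ S : Finset ι, ∀ i ∈ Sᶜ, F (S.piecewise (fun j => t (update z i (t (z i)) j))
      (update z i (t (z i)))) = F ((insert i S).piecewise (fun j => t (z j)) z) := by
    intro S i hi
    congr 1
    ext j
    by_cases hj : j = i
    · subst hj
      simp [mem_compl.1 hi]
    · by_cases hS : j ∈ S <;> simp [hj, hS]
  simp only [slotSum, subsetSum]
  rw [sum_comm]
  have hsplit : ∀ S ∈ powersetCard k (univ : Finset ι),
      ∑ i, F (S.piecewise (fun j => t (update z i (t (z i)) j)) (update z i (t (z i)))) =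
        ∑ i ∈ Sᶜ, F ((insert i S).piecewise (fun j => t (z j)) z) := by
    intro S _
    rw [← sum_add_sum_compl S, sum_eq_zero (hmem S), zero_add, sum_congr rfl (hnot S)]
  rw [sum_congr rfl hsplit, sum_powersetCard_sum_compl, smul_sum]
  refine sum_congr rfl fun S hS => ?_
  rw [mem_powersetCard_univ] at hS
  rw [← hS, ← sum_const]
  exact sum_congr rfl fun i hi => by rw [insert_erase hi]

/-- The operator `F ↦ [F, t]` on functions of several variables in `W` with values in `W`. -/
def derive (t : W →ₗ[K] W) (F : (ι → W) → W) (z : ι → W) : W :=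
  slotSum t F z - t (F z)

theorem iterate_derive {t : W →ₗ[K] W} (ht : ∀ w, t (t w) = 0)
    (F : MultilinearMap K (fun _ : ι => W) W) (k : ℕ) :
    (derive t)^[k + 1] F = fun z =>
      (k + 1).factorial • (subsetSum t F (k + 1) z - t (subsetSum t F k z)) := by
  have hs := slotSum_subsetSum ht F
  induction k with
  | zero =>
    ext z
    have h0 := congrFun (hs 0) z
    simp only [subsetSum_zero] at h0
    simp [derive, h0, subsetSum_zero]
  | succ k ih =>
    ext z
    rw [iterate_succ_apply', ih]
    have h1 := congrFun (hs (k + 1)) z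
    have h2 := congrFun (hs k) z
    simp only [slotSum] at h1 h2
    -- Up to the factor `(k + 1)!`, the two terms contribute `(k + 2)` copies of the `(k +
    -- 2)`-subset sum and `-(k + 1)` copies of `t` of the `(k + 1)`-subset sum. The outer `-t` adds
    -- one more of the latter and kills the rest, so `k + 2` factors out.
    simp only [derive, slotSum, ← smul_sum, sum_sub_distrib, ← map_sum, h1, h2, map_nsmul, map_sub,
      ht, sub_zero]
    rw [Nat.factorial_succ (k + 1)]
    module

theorem subsetSum_comp_perm (t : W →ₗ[K] W) (F : W [⋀^ι]→ₗ[K] W) (k : ℕ) (z : ι → W)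
    (σ : Equiv.Perm ι) :
    subsetSum t F k (z ∘ σ) = Equiv.Perm.sign σ • subsetSum t F k z := by
  simp only [subsetSum, smul_sum]
  refine sum_equiv σ.finsetCongr ?_ ?_
  · intro S
    simp
  · intro S _
    rw [← AlternatingMap.map_perm]
    congr 1
    ext j
    by_cases hj : j ∈ S <;> simp [hj, Finset.piecewise]

end SlotSums

/-! ### The twisted semidirect bracket in terms of `[-, …, -]_T` and `ρ_T`. -/

section TwistedBracket

variable {K g V : Type*} [Field K] [AddCommGroup g] [Module K g] [AddCommGroup V] [Module K V]
  {r : ℕ}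

/-- The map `T : V → g` regarded as an endomorphism of `g ⊕ V`. -/
def liftLinear (T : V →ₗ[K] g) : g × V →ₗ[K] g × V :=
  LinearMap.inl K g V ∘ₗ T ∘ₗ LinearMap.snd K g V

@[simp]
theorem liftLinear_apply (T : V →ₗ[K] g) (w : g × V) : liftLinear T w = (T w.2, 0) := rfl

/-- The map `(w, w₁, …, wₙ₋₁) ↦ ρ(x₁, …, xₙ₋₁) u` for `w = (x, u)` and `wᵢ = (xᵢ, uᵢ)`. -/
def actionCurried (ρ : g [⋀^Fin r]→ₗ[K] Module.End K V) :
    g × V →ₗ[K] (g × V) [⋀^Fin r]→ₗ[K] V where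
  toFun w := ((LinearMap.applyₗ w.2).compAlternatingMap ρ).compLinearMap (LinearMap.fst K g V)
  map_add' w w' := by ext; simp
  map_smul' c w := by ext; simp

/-- The semidirect product bracket as an alternating map. -/
def semidirectAlternating (μ : g [⋀^Fin (r + 1)]→ₗ[K] g) (ρ : g [⋀^Fin r]→ₗ[K] Module.End K V) :
    (g × V) [⋀^Fin (r + 1)]→ₗ[K] (g × V) :=
  (μ.compLinearMap (LinearMap.fst K g V)).prod
    ((-1 : ℤ) ^ r • AlternatingMap.alternatizeUncurryFin (actionCurried ρ))

theorem semidirectAlternating_apply (μ : g [⋀^Fin (r + 1)]→ₗ[K] g)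
    (ρ : g [⋀^Fin r]→ₗ[K] Module.End K V) (z : Fin (r + 1) → g × V) :
    semidirectAlternating μ ρ z = (μ fun i => (z i).1,
      ∑ i : Fin (r + 1), (-1 : ℤ) ^ (r + (i : ℕ)) • ρ (i.removeNth fun j => (z j).1) (z i).2) := by
  refine Prod.ext rfl ?_
  simp only [semidirectAlternating, AlternatingMap.prod_apply, AlternatingMap.smul_apply,
    AlternatingMap.alternatizeUncurryFin_apply, smul_sum, smul_smul, ← pow_add]
  rfl

/-- The bracket of the semidirect product of `(V, [-, …, -]_T)` and `(g; ρ_T)`, written as the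
twist by `T` of the one of `(g, μ)` and `(V; ρ)`. -/
def twistedBracket (μ : g [⋀^Fin (r + 1)]→ₗ[K] g) (ρ : g [⋀^Fin r]→ₗ[K] Module.End K V)
    (T : V →ₗ[K] g) (z : Fin (r + 1) → g × V) : g × V :=
  subsetSum (liftLinear T) (semidirectAlternating μ ρ) r z -
    liftLinear T (subsetSum (liftLinear T) (semidirectAlternating μ ρ) (r - 1) z)

theorem twistedBracket_comp_perm (μ : g [⋀^Fin (r + 1)]→ₗ[K] g)
    (ρ : g [⋀^Fin r]→ₗ[K] Module.End K V) (T : V →ₗ[K] g) (z : Fin (r + 1) → g × V)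
    (σ : Equiv.Perm (Fin (r + 1))) :
    twistedBracket μ ρ T (z ∘ σ) = Equiv.Perm.sign σ • twistedBracket μ ρ T z := by
  simp only [twistedBracket, subsetSum_comp_perm, smul_sub, Units.smul_def, map_zsmul]

/-- The value of `ρ_T` for a vector `x` of `g` at the place `j` instead of the last one. -/
def rhoTAt (μ : g [⋀^Fin (r + 1)]→ₗ[K] g) (ρ : g [⋀^Fin r]→ₗ[K] Module.End K V) (T : V →ₗ[K] g)
    (u : Fin (r + 1) → V) (j : Fin (r + 1)) (x : g) : g :=
  μ (update (fun i => T (u i)) j x) - ∑ i ∈ univ.erase j, (-1 : ℤ) ^ (r + (i : ℕ)) •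
    T (ρ (i.removeNth (update (fun i => T (u i)) j x)) (u i))

/-- Exactly one slot `j` escapes `T`. All others have zero `V`-component, so only the vector in slot
`j` can be acted upon. -/
theorem subsetSum_semidirectAlternating (μ : g [⋀^Fin (r + 1)]→ₗ[K] g)
    (ρ : g [⋀^Fin r]→ₗ[K] Module.End K V) (T : V →ₗ[K] g) (z : Fin (r + 1) → g × V) :
    subsetSum (liftLinear T) (semidirectAlternating μ ρ) r z =
      (∑ j, μ (update (fun i => T (z i).2) j (z j).1), bracketT ρ T fun i => (z i).2) := by
  rw [subsetSum, sum_powersetCard_card_sub_one (by simp)]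
  refine Prod.ext ?_ ?_
  · simp only [Prod.fst_sum, semidirectAlternating_apply]
    refine sum_congr rfl fun j _ => congrArg μ ?_
    ext i
    by_cases hi : i = j
    · subst hi; simp
    · simp [hi]
  · simp only [Prod.snd_sum, semidirectAlternating_apply, bracketT]
    refine sum_congr rfl fun j _ => ?_
    rw [sum_eq_single j]
    · congr 2
      · congr 1
        ext i
        simp [Fin.removeNth]
      · simp
    · intro i _ hi
      simp [hi]
    · simp

theorem snd_subsetSum_semidirectAlternating (hr : 1 ≤ r) (μ : g [⋀^Fin (r + 1)]→ₗ[K] g)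
    (ρ : g [⋀^Fin r]→ₗ[K] Module.End K V) (T : V →ₗ[K] g) (z : Fin (r + 1) → g × V) :
    (subsetSum (liftLinear T) (semidirectAlternating μ ρ) (r - 1) z).2 =
      ∑ j : Fin (r + 1), ∑ i ∈ univ.erase j, (-1 : ℤ) ^ (r + (i : ℕ)) •
        ρ (i.removeNth (update (fun i => T (z i).2) j (z j).1)) (z i).2 := by
  have key : ∀ S : Finset (Fin (r + 1)),
      (semidirectAlternating μ ρ (S.piecewise (fun i => liftLinear T (z i)) z)).2 =
      ∑ i ∈ Sᶜ, (-1 : ℤ) ^ (r + (i : ℕ)) •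
        ρ (i.removeNth (S.piecewise (fun i => T (z i).2) fun i => (z i).1)) (z i).2 := by
    intro S
    rw [semidirectAlternating_apply, ← sum_add_sum_compl S, sum_eq_zero, zero_add]
    · refine sum_congr rfl fun i hi => ?_
      rw [mem_compl] at hi
      congr 3
      · ext k
        by_cases hk : i.succAbove k ∈ S <;> simp [Fin.removeNth, hk]
      · simp [hi]
    · intro i hi
      simp [hi]
  -- Two slots escape `T`: `i`, whose vector is acted upon, and `j`, which supplies its
  -- `g`-component. Adding `i` to the subset leaves the complement of `{j}`; `1 ≤ r` makes `(r - 1)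
  -- + 1 = r` despite truncated subtraction.
  rw [subsetSum, Prod.snd_sum, sum_congr rfl fun S _ => key S, sum_powersetCard_sum_compl,
    sum_powersetCard_card_sub_one (by simp; omega)]
  refine sum_congr rfl fun j _ => sum_congr rfl fun i _ => ?_
  congr 3
  ext k
  by_cases hk : i.succAbove k = j
  · subst hk; simp [Fin.removeNth]
  · simp [Fin.removeNth, hk]

theorem twistedBracket_apply (hr : 1 ≤ r) (μ : g [⋀^Fin (r + 1)]→ₗ[K] g)
    (ρ : g [⋀^Fin r]→ₗ[K] Module.End K V) (T : V →ₗ[K] g) (z : Fin (r + 1) → g × V) :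
    twistedBracket μ ρ T z =
      (∑ j, rhoTAt μ ρ T (fun i => (z i).2) j (z j).1, bracketT ρ T fun i => (z i).2) := by
  rw [twistedBracket, subsetSum_semidirectAlternating, liftLinear_apply,
    snd_subsetSum_semidirectAlternating hr]
  refine Prod.ext ?_ ?_
  · simp only [Prod.fst_sub, rhoTAt, sum_sub_distrib, map_sum, map_zsmul]
  · simp

theorem rhoTAt_last (μ : g [⋀^Fin (r + 1)]→ₗ[K] g)
    (ρ : g [⋀^Fin r]→ₗ[K] Module.End K V) (T : V →ₗ[K] g) (u : Fin (r + 1) → V) (x : g) :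
    rhoTAt μ ρ T u (Fin.last r) x = rhoT μ ρ T (fun i => u i.castSucc) x := by
  have h : update (fun i => T (u i)) (Fin.last r) x =
      (Fin.snoc (fun i : Fin r => T (u i.castSucc)) x : Fin (r + 1) → g) := by
    ext i
    refine Fin.lastCases ?_ (fun i => ?_) i <;> simp [Fin.castSucc_ne_last]
  rw [rhoTAt, rhoT, h, ← sdiff_singleton_eq_erase, sum_sdiff_eq_sub (subset_univ _),
    Fin.sum_univ_castSucc]
  simp

/-- If the `V`-component of an argument vanishes, then the bracket is a value of `ρ_T`. -/
theorem twistedBracket_of_snd_eq_zero (hr : 1 ≤ r) (μ : g [⋀^Fin (r + 1)]→ₗ[K] g)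
    (ρ : g [⋀^Fin r]→ₗ[K] Module.End K V) (T : V →ₗ[K] g) (z : Fin (r + 1) → g × V)
    (j : Fin (r + 1)) (hj : (z j).2 = 0) :
    twistedBracket μ ρ T z = (rhoTAt μ ρ T (fun i => (z i).2) j (z j).1, 0) := by
  rw [twistedBracket_apply hr]
  -- Either position `j` is the omitted one, and the vector acted upon is zero, or it survives as a
  -- zero argument of `ρ`.
  have hρ : ∀ (w : Fin (r + 1) → g) (i : Fin (r + 1)), w j = 0 →
      ρ (i.removeNth w) (z i).2 = 0 := by
    intro w i hw
    by_cases hi : i = j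
    · rw [hi, hj, map_zero]
    · obtain ⟨l, hl⟩ := Fin.exists_succAbove_eq (Ne.symm hi)
      have h0 : i.removeNth w l = 0 := by rw [Fin.removeNth, hl, hw]
      rw [ρ.map_coord_zero l h0, LinearMap.zero_apply]
  refine Prod.ext ?_ ?_
  · refine sum_eq_single j (fun k _ hk => ?_) fun h => absurd (mem_univ j) h
    have h0 : update (fun i => T (z i).2) k (z k).1 j = 0 := by
      rw [update_of_ne hk.symm, hj, map_zero]
    rw [rhoTAt, μ.map_coord_zero j h0, sum_eq_zero, sub_zero]
    intro i _
    rw [hρ _ i h0, map_zero, smul_zero]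
  · change bracketT ρ T _ = 0
    refine sum_eq_zero fun i _ => ?_
    rw [hρ (fun i => T (z i).2) i (by rw [hj, map_zero]), smul_zero]

theorem twistedBracket_snoc (hr : 1 ≤ r) (μ : g [⋀^Fin (r + 1)]→ₗ[K] g)
    (ρ : g [⋀^Fin r]→ₗ[K] Module.End K V) (T : V →ₗ[K] g) (X : Fin r → g × V) (x : g) :
    twistedBracket μ ρ T (Fin.snoc X (x, 0)) = (rhoT μ ρ T (fun i => (X i).2) x, 0) := by
  rw [twistedBracket_of_snd_eq_zero hr μ ρ T _ (Fin.last r) (by simp), rhoTAt_last]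
  simp

theorem insertNth_comp_cycleRange_last {α : Type*} (i : Fin (r + 1)) (x : α) (X : Fin r → α) :
    (i.insertNth x X : Fin (r + 1) → α) =
      (Fin.snoc X x : Fin (r + 1) → α) ∘ ((Fin.last r).cycleRange.symm * i.cycleRange) := by
  rw [← Fin.insertNth_last' x X, Equiv.Perm.coe_mul, ← comp_assoc,
    Fin.insertNth_comp_cycleRange_symm, Fin.cons_comp_cycleRange]

/-- The twisted bracket is skew-symmetric, so moving the entry from place `i` to the last place
costs the sign of two cycles, `(-1)^(r + i)`. -/
theorem twistedBracket_insertNth (hr : 1 ≤ r) (μ : g [⋀^Fin (r + 1)]→ₗ[K] g)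
    (ρ : g [⋀^Fin r]→ₗ[K] Module.End K V) (T : V →ₗ[K] g) (i : Fin (r + 1)) (X : Fin r → g × V)
    (x : g) :
    twistedBracket μ ρ T (i.insertNth (x, 0) X) =
      (-1 : ℤ) ^ (r + (i : ℕ)) • (rhoT μ ρ T (fun i => (X i).2) x, 0) := by
  rw [insertNth_comp_cycleRange_last, twistedBracket_comp_perm, twistedBracket_snoc hr]
  simp [Units.smul_def, pow_add]

theorem twistedBracket_snoc_update (hr : 1 ≤ r) (μ : g [⋀^Fin (r + 1)]→ₗ[K] g)
    (ρ : g [⋀^Fin r]→ₗ[K] Module.End K V) (T : V →ₗ[K] g) (i : Fin r) (X : Fin r → g × V)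
    (x : g) (y : g × V) :
    twistedBracket μ ρ T (Fin.snoc (update X i (x, 0)) y) =
      (-1 : ℤ) ^ (r + (i : ℕ)) • (rhoT μ ρ T (i.castSucc.removeNth
        (Fin.snoc (fun j => (X j).2) y.2 : Fin (r + 1) → V)) x, 0) := by
  have h : (Fin.snoc (update X i (x, 0)) y : Fin (r + 1) → g × V) =
      i.castSucc.insertNth (x, 0)
        (i.castSucc.removeNth (Fin.snoc X y : Fin (r + 1) → g × V)) := by
    rw [Fin.insertNth_removeNth, Fin.snoc_update]
  rw [h, twistedBracket_insertNth hr]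
  congr 3
  ext k
  simp only [Fin.removeNth]
  refine Fin.lastCases ?_ (fun l => ?_) (i.castSucc.succAbove k) <;> simp

end TwistedBracket

/-! ### Shuffles with a block of size zero or one. -/

section Shuffles

theorem strictMono_perm_eq_one {N : ℕ} (σ : Equiv.Perm (Fin N)) (h : StrictMono σ) : σ = 1 := by
  have := (h.range_inj strictMono_id).1 (by simp [σ.surjective.range_eq])
  exact Equiv.ext fun i => congrFun this i

theorem shuffles_zero_left {N b : ℕ} (hN : N ≤ b + 1) : shuffles N 0 b = {1} := by
  ext σ
  simp only [shuffles, mem_filter, mem_univ, true_and, mem_singleton]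
  constructor
  · rintro ⟨-, h2, h3⟩
    refine strictMono_perm_eq_one σ fun i j hij => ?_
    by_cases hj : (j : ℕ) < b
    · exact h2 i j (Nat.zero_le _) hij (by omega)
    · rw [h3 j (by omega)]
      refine lt_of_le_of_ne (Fin.le_def.2 (by omega)) fun h => hij.ne ?_
      exact σ.injective (h.trans (h3 j (by omega)).symm)
  · rintro rfl
    simp +contextual

/-- The permutation that sends `k` to `j` and is increasing on the other letters. -/
def moveTo {M : ℕ} (k j : Fin (M + 1)) : Equiv.Perm (Fin (M + 1)) :=
  j.cycleRange.symm * k.cycleRange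

variable {M : ℕ}

@[simp]
theorem moveTo_self (k j : Fin (M + 1)) : moveTo k j k = j := by
  simp [moveTo]

@[simp]
theorem moveTo_succAbove (k j : Fin (M + 1)) (a : Fin M) :
    moveTo k j (k.succAbove a) = j.succAbove a := by
  simp [moveTo]

theorem sign_moveTo (k j : Fin (M + 1)) :
    (Equiv.Perm.sign (moveTo k j) : ℤ) = (-1) ^ ((k : ℕ) + (j : ℕ)) := by
  simp [moveTo, pow_add, mul_comm]

/-- An increasing map on a finite chain is determined by its range, which here is the complement of
`σ k`. -/
theorem eq_moveTo {σ : Equiv.Perm (Fin (M + 1))} {k : Fin (M + 1)}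
    (h : StrictMono (σ ∘ k.succAbove)) : σ = moveTo k (σ k) := by
  have hr : Set.range (σ ∘ k.succAbove) = Set.range (σ k).succAbove := by
    rw [Set.range_comp, Fin.range_succAbove, Fin.range_succAbove,
      Set.image_compl_eq σ.bijective, Set.image_singleton]
  have := (h.range_inj (Fin.strictMono_succAbove _)).1 hr
  ext i
  refine congrArg Fin.val ?_
  by_cases hi : i = k
  · rw [hi, moveTo_self]
  · obtain ⟨a, rfl⟩ := Fin.exists_succAbove_eq hi
    rw [moveTo_succAbove]
    exact congrFun this a

/-- Letters above `k` are fixed and the first `k` stay in order, so the shuffle is determined by the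
image `j ≤ k` of the letter `k`. -/
theorem shuffles_one_right (k : Fin (M + 1)) :
    shuffles (M + 1) k 1 = (univ.filter (· ≤ k)).image (moveTo k) := by
  ext σ
  simp only [shuffles, mem_filter, mem_univ, true_and, mem_image]
  constructor
  · rintro ⟨h1, -, h3⟩
    -- A value above `k` would be a fixed letter, hence equal to `i` by injectivity.
    have hle : ∀ i, i ≤ k → σ i ≤ k := by
      intro i hi
      by_contra hlt
      rw [not_le] at hlt
      have := σ.injective (h3 (σ i) (by omega))
      omega
    refine ⟨σ k, hle k le_rfl, (eq_moveTo ?_).symm⟩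
    intro a b hab
    have hab' := Fin.strictMono_succAbove k hab
    have hb := Fin.succAbove_ne k b
    by_cases hbk : k.succAbove b < k
    · exact h1 _ _ hab' hbk
    · have hbk' : k < k.succAbove b := lt_of_le_of_ne (not_lt.1 hbk) hb.symm
      simp only [comp_apply]
      rw [h3 (k.succAbove b) (by omega)]
      by_cases hak : k.succAbove a ≤ k
      · exact (hle _ hak).trans_lt hbk'
      · rw [h3 (k.succAbove a) (by omega)]
        exact hab'
  · rintro ⟨j, hj, rfl⟩
    refine ⟨?_, ?_, ?_⟩
    · intro a b hab hb
      obtain ⟨a, rfl⟩ := Fin.exists_succAbove_eq (x := a) (y := k) (by rintro rfl; omega)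
      obtain ⟨b, rfl⟩ := Fin.exists_succAbove_eq (x := b) (y := k) (by rintro rfl; omega)
      rw [moveTo_succAbove, moveTo_succAbove]
      exact Fin.strictMono_succAbove j ((Fin.strictMono_succAbove k).lt_iff_lt.1 hab)
    · intro a b ha hab hb
      omega
    · intro a ha
      obtain ⟨a, rfl⟩ := Fin.exists_succAbove_eq (x := a) (y := k) (by rintro rfl; omega)
      rw [moveTo_succAbove]
      have hka : k ≤ a.castSucc := by
        by_contra hlt
        rw [not_le] at hlt
        rw [Fin.succAbove_of_castSucc_lt _ _ hlt] at ha
        have := Fin.lt_def.1 hlt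
        omega
      rw [Fin.succAbove_of_le_castSucc _ _ hka, Fin.succAbove_of_le_castSucc _ _ (hj.trans hka)]

theorem shuffles_one_left : shuffles (M + 1) 1 M = univ.image (moveTo (0 : Fin (M + 1))) := by
  ext σ
  simp only [shuffles, mem_filter, mem_univ, true_and, mem_image]
  constructor
  · rintro ⟨-, h2, -⟩
    refine ⟨σ 0, (eq_moveTo ?_).symm⟩
    intro a b hab
    simp only [comp_apply, Fin.zero_succAbove]
    exact h2 _ _ (by simp) (Fin.succ_lt_succ_iff.2 hab) (by simp; omega)
  · rintro ⟨j, rfl⟩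
    refine ⟨?_, ?_, ?_⟩
    · intro a b hab hb
      have := Fin.lt_def.1 hab
      omega
    · intro a b ha hab hb
      obtain ⟨a, rfl⟩ := Fin.exists_succAbove_eq (x := a) (y := 0) (by rintro rfl; simp at ha)
      obtain ⟨b, rfl⟩ := Fin.exists_succAbove_eq (x := b) (y := 0) (by rintro rfl; simp at hab)
      rw [moveTo_succAbove, moveTo_succAbove]
      exact Fin.strictMono_succAbove j ((Fin.strictMono_succAbove 0).lt_iff_lt.1 hab)
    · intro a ha
      omega

theorem moveTo_injective (k : Fin (M + 1)) : Injective (moveTo k) := fun i j h => by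
  simpa using congrArg (fun σ => σ k) h

theorem sum_shuffles_one_right {A : Type*} [AddCommMonoid A] (k : Fin (M + 1))
    (F : Equiv.Perm (Fin (M + 1)) → A) :
    ∑ σ ∈ shuffles (M + 1) k 1, F σ = ∑ j, if j ≤ k then F (moveTo k j) else 0 := by
  rw [shuffles_one_right, sum_image (moveTo_injective k).injOn, sum_filter]

theorem sum_shuffles_one_left {A : Type*} [AddCommMonoid A] (F : Equiv.Perm (Fin (M + 1)) → A) :
    ∑ σ ∈ shuffles (M + 1) 1 M, F σ = ∑ j, F (moveTo 0 j) := by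
  rw [shuffles_one_left, sum_image (moveTo_injective 0).injOn]

end Shuffles

/-! ### Compositions and graded brackets with an `n`-ary operation. -/

section Circ

variable {W : Type*} [AddCommGroup W] {r p : ℕ}

/-- An `n`-ary operation as an element of degree `1`. -/
def ofNary (F : (Fin (r + 1) → W) → W) : Func r 1 W W := fun X x => F (Fin.snoc (X 0) x)

theorem shuffles_one_letter (a b : ℕ) : shuffles 1 a b = {1} := by
  ext σ
  simp [shuffles, Subsingleton.elim σ 1, Fin.lt_def]

/-- The two sums of `circ` insert `T` into the first `r` slots and into the last one; the opposite
composition applies `T` to the value. -/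
theorem gradedBracket_ofNary_degree_zero {K g V : Type*} [Field K] [AddCommGroup g] [Module K g]
    [AddCommGroup V] [Module K V] (h : 1 + 0 = 1) (F : (Fin (r + 1) → g × V) → g × V)
    (T : V →ₗ[K] g) :
    gradedBracket h (ofNary F) (lift fun _ v => T v) = ofNary (derive (liftLinear T) F) := by
  ext1 X
  ext1 x
  have hlast : (Fin.snoc (X 0) (T x.2, 0) : Fin (r + 1) → g × V) =
      update (Fin.snoc (X 0) x : Fin (r + 1) → g × V) (Fin.last r) (T x.2, 0) :=
    (Fin.update_snoc_last _ _ _).symm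
  have hcast : ∀ i : Fin r, (Fin.snoc (update (X 0) i (T (X 0 i).2, 0)) x : Fin (r + 1) → g × V) =
      update (Fin.snoc (X 0) x : Fin (r + 1) → g × V) i.castSucc (T (X 0 i).2, 0) := by
    intro i
    rw [Fin.snoc_update]
  simp [gradedBracket, circ, ofNary, derive, slotSum, lift, shuffles_one_letter, hlast, hcast,
    Fin.sum_univ_castSucc]

theorem circ_ofNary_left (h : 1 + p = p + 1) (F : (Fin (r + 1) → W) → W) (Q : Func r p W W)
    (X : Fin (p + 1) → Fin r → W) (x : W) :
    circ h (ofNary F) Q X x =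
      (∑ i : Fin r, F (Fin.snoc (update (X (Fin.last p)) i
        (Q (fun a => X a.castSucc) (X (Fin.last p) i))) x)) +
      (-1 : ℤ) ^ p • ∑ j : Fin (p + 1), (-1 : ℤ) ^ (j : ℕ) •
        F (Fin.snoc (X j) (Q (j.removeNth X) x)) := by
  rw [circ]
  congr 1
  · rw [Fin.sum_univ_one]
    simp only [Fin.val_zero, zero_mul, pow_zero, one_smul, shuffles_zero_left le_rfl, sum_singleton,
      Equiv.Perm.sign_one, Units.val_one, Equiv.Perm.one_apply, ofNary, lt_irrefl, if_false, if_true,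
      zero_add]
    rfl
  · rw [one_mul, sum_shuffles_one_left]
    congr 1
    refine sum_congr rfl fun j _ => ?_
    rw [sign_moveTo, Fin.val_zero, zero_add]
    congr 1
    have h0 : moveTo 0 j ⟨((0 : Fin 1) : ℕ), by simp⟩ = j := moveTo_self 0 j
    have h1 : ∀ l : Fin p, moveTo 0 j ⟨1 + (l : ℕ), by omega⟩ = j.succAbove l := by
      intro l
      rw [← moveTo_succAbove 0 j l]
      congr 1
      ext
      simp [add_comm]
    simp only [ofNary, h0, h1]
    rfl

/-- As `j ≤ k`, removing block `j` shifts the original block `k + 1` to position `k`, where the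
value is inserted. -/
theorem blocks_moveTo {A : Type*} (X : Fin (p + 1) → A) (w : A) (k : Fin p) (j : Fin (p + 1))
    (hj : j ≤ k.castSucc) :
    (fun a : Fin p => if a < k then X (moveTo k.castSucc j ⟨a, by omega⟩)
      else if a = k then w else X ⟨(a : ℕ) + 1, by omega⟩) =
      update (j.removeNth X) k w := by
  ext a
  rcases lt_trichotomy a k with h | rfl | h
  · have ha : (⟨(a : ℕ), by omega⟩ : Fin (p + 1)) = k.castSucc.succAbove a :=
      (Fin.succAbove_of_castSucc_lt _ _ (Fin.castSucc_lt_castSucc_iff.2 h)).symm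
    rw [if_pos h, ha, moveTo_succAbove, update_of_ne h.ne]
    rfl
  · simp
  · have ha : (⟨(a : ℕ) + 1, by omega⟩ : Fin (p + 1)) = j.succAbove a :=
      (Fin.succAbove_of_le_castSucc _ _ (hj.trans (Fin.castSucc_le_castSucc_iff.2 h.le))).symm
    rw [if_neg h.not_gt, if_neg h.ne', ha, update_of_ne h.ne']
    rfl

/-- The sign `(-1)^k` in front of the shuffles cancels the `k` in the sign `(-1)^(k + j)` of the
shuffle, leaving `(-1)^j`. -/
theorem circ_ofNary_right (h : p + 1 = p + 1) (F : (Fin (r + 1) → W) → W) (P : Func r p W W)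
    (X : Fin (p + 1) → Fin r → W) (x : W) :
    circ h P (ofNary F) X x =
      (∑ j : Fin (p + 1), ∑ k : Fin p, if j ≤ k.castSucc then
        (-1 : ℤ) ^ (j : ℕ) • ∑ i : Fin r, P (update (j.removeNth X) k
          (update (X k.succ) i (F (Fin.snoc (X j) (X k.succ i))))) x
        else 0) +
      ∑ j : Fin (p + 1), (-1 : ℤ) ^ (j : ℕ) • P (j.removeNth X) (F (Fin.snoc (X j) x)) := by
  have hsign : ∀ a b : ℕ, (-1 : ℤ) ^ a * (-1) ^ (a + b) = (-1) ^ b := by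
    intro a b
    rw [pow_add, ← mul_assoc, ← pow_add, Even.neg_one_pow ⟨a, rfl⟩, one_mul]
  rw [circ]
  congr 1
  · rw [sum_comm]
    refine sum_congr rfl fun k _ => ?_
    refine (congrArg _ (sum_shuffles_one_right k.castSucc _)).trans ?_
    rw [smul_sum]
    refine sum_congr rfl fun j _ => ?_
    split_ifs with hj
    · rw [sign_moveTo, smul_smul, Fin.val_castSucc, mul_one, hsign]
      congr 1
      refine sum_congr rfl fun i _ => ?_
      have h0 : moveTo k.castSucc j ⟨(k : ℕ) + ((0 : Fin 1) : ℕ), by simp⟩ = j :=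
        moveTo_self _ j
      simp only [ofNary, h0]
      rw [blocks_moveTo X _ k j hj]
      rfl
    · exact smul_zero _
  · refine (congrArg _ (sum_shuffles_one_right (Fin.last p) _)).trans ?_
    rw [smul_sum]
    refine sum_congr rfl fun j _ => ?_
    rw [if_pos (Fin.le_last j), sign_moveTo, smul_smul, Fin.val_last, mul_one, hsign]
    congr 1
    have h0 : moveTo (Fin.last p) j ⟨p + ((0 : Fin 1) : ℕ), by simp⟩ = j := moveTo_self _ j
    have h1 : ∀ l : Fin p, moveTo (Fin.last p) j ⟨(l : ℕ), by omega⟩ = j.succAbove l := by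
      intro l
      rw [← moveTo_succAbove (Fin.last p) j l, Fin.succAbove_last]
      rfl
    simp only [ofNary, h0, h1]
    rfl

end Circ

/-! ### The differential as a single graded bracket, and comparison with the coboundary. -/

section Main

variable {K g V : Type*} [Field K] [AddCommGroup g] [Module K g] [AddCommGroup V] [Module K V]
  {r : ℕ}

theorem iteratedBracket_ofNary (F : (Fin (r + 1) → g × V) → g × V) (T : V →ₗ[K] g) (j : ℕ)
    (h : 1 + ∑ _i : Fin j, 0 = 1) :
    iteratedBracket (ofNary F) j
      (fun _ => (⟨0, fun _ v => T v⟩ : Σ p : ℕ, Func r p V g)) 1 h =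
      ofNary ((derive (liftLinear T))^[j] F) := by
  induction j with
  | zero => rfl
  | succ j ih =>
    -- The recursion produces the degree `1 + ∑ 0`, equal to `1` only propositionally; a variable
    -- `q` allows the substitution.
    have key : ∀ (q : ℕ) (hq : 1 + ∑ _i : Fin j, 0 = q) (hN : q + 0 = 1),
        gradedBracket hN (iteratedBracket (ofNary F) j
          (fun _ => (⟨0, fun _ v => T v⟩ : Σ p : ℕ, Func r p V g)) q hq)
          (lift fun _ v => T v) = ofNary ((derive (liftLinear T))^[j + 1] F) := by
      intro q hq hN
      obtain rfl : q = 1 := hN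
      rw [ih, gradedBracket_ofNary_degree_zero, iterate_succ_apply']
    exact key _ rfl _

theorem iteratedBracket_snoc (F : (Fin (r + 1) → g × V) → g × V) (T : V →ₗ[K] g) {p : ℕ}
    (f : Func r p V g) (P : Fin (r + 1) → Σ p : ℕ, Func r p V g)
    (hP : (fun i : Fin r => P i.castSucc) = fun _ => ⟨0, fun _ v => T v⟩)
    (hf : P (Fin.last r) = ⟨p, f⟩) (h : 1 + ∑ i, (P i).1 = p + 1) :
    iteratedBracket (ofNary F) (r + 1) P (p + 1) h =
      gradedBracket (add_comm 1 p) (ofNary ((derive (liftLinear T))^[r] F)) (lift f) := by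
  have key : ∀ (P' : Fin r → Σ p : ℕ, Func r p V g)
      (_ : P' = fun _ => ⟨0, fun _ v => T v⟩) (R : Σ p : ℕ, Func r p V g)
      (_ : R = ⟨p, f⟩) (q : ℕ) (hq : 1 + ∑ i, (P' i).1 = q) (hN : q + R.1 = p + 1),
      gradedBracket hN (iteratedBracket (ofNary F) r P' q hq) (lift R.2) =
        gradedBracket (add_comm 1 p) (ofNary ((derive (liftLinear T))^[r] F)) (lift f) := by
    rintro _ rfl _ rfl q hq hN
    obtain rfl : q = 1 := by
      change q + p = p + 1 at hN
      omega
    rw [iteratedBracket_ofNary]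
  exact key _ hP _ hf _ rfl _

theorem semidirect_eq_ofNary (μ : g [⋀^Fin (r + 1)]→ₗ[K] g)
    (ρ : g [⋀^Fin r]→ₗ[K] Module.End K V) :
    semidirect μ ρ = ofNary (semidirectAlternating μ ρ) := by
  ext1 X
  ext1 x
  rw [ofNary, semidirectAlternating_apply]
  rfl

theorem iterate_derive_semidirectAlternating (hr : 1 ≤ r) (μ : g [⋀^Fin (r + 1)]→ₗ[K] g)
    (ρ : g [⋀^Fin r]→ₗ[K] Module.End K V) (T : V →ₗ[K] g) :
    (derive (liftLinear T))^[r] (semidirectAlternating μ ρ) =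
      fun z => (r.factorial : K) • twistedBracket μ ρ T z := by
  -- This turns the truncated `r - 1` in `twistedBracket` into `s`, as in `iterate_derive`.
  obtain ⟨s, rfl⟩ : ∃ s, r = s + 1 := ⟨r - 1, by omega⟩
  have h := iterate_derive (t := liftLinear T) (fun w => by simp)
    (semidirectAlternating μ ρ).toMultilinearMap s
  refine h.trans (funext fun z => ?_)
  rw [Nat.cast_smul_eq_nsmul]
  rfl

theorem l1T_eq (hr : 1 ≤ r) (μ : g [⋀^Fin (r + 1)]→ₗ[K] g)
    (ρ : g [⋀^Fin r]→ₗ[K] Module.End K V) (T : V →ₗ[K] g) {p : ℕ} (f : Func r p V g) :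
    l1T μ ρ T f = (r.factorial : K)⁻¹ • gradedBracket (add_comm 1 p)
      (ofNary fun z => (r.factorial : K) • twistedBracket μ ρ T z) (lift f) := by
  rw [l1T, lieNBracket, semidirect_eq_ofNary, ← iterate_derive_semidirectAlternating hr,
    iteratedBracket_snoc _ T f _ (by simp) (by simp)]

/-- The bracket with a cochain is homogeneous in the other factor. -/
theorem inv_smul_gradedBracket_ofNary_smul {c : K} (hc : c ≠ 0)
    (F : (Fin (r + 1) → g × V) → g × V) {p : ℕ} {f : Func r p V g} (hf : IsCochain K f) :
    c⁻¹ • gradedBracket (add_comm 1 p) (ofNary fun z => c • F z) (lift f) =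
      gradedBracket (add_comm 1 p) (ofNary F) (lift f) := by
  have hblock : ∀ (X : Fin p → Fin r → g × V) (Y : Fin r → g × V) (x : g × V) (k : Fin p)
      (i : Fin r) (w : g × V), lift f (update X k (update Y i (c • w))) x =
        c • lift f (update X k (update Y i w)) x := by
    intro X Y x k i w
    have hlift : ∀ v : g × V, (fun a b => (update X k (update Y i v) a b).2) =
        update (fun a b => (update X k Y a b).2) k
          (update ((fun a b => (update X k Y a b).2) k) i v.2) := by
      intro v
      ext a b
      by_cases ha : a = k
      · subst ha
        by_cases hb : b = i
        · subst hb; simp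
        · simp [hb]
      · simp [ha]
    refine Prod.ext ?_ (by simp [lift])
    change f _ _ = c • f _ _
    rw [hlift, hlift, Prod.smul_snd, hf.smul_block]
  have hlast : ∀ (X : Fin p → Fin r → g × V) (w : g × V),
      lift f X (c • w) = c • lift f X w := by
    intro X w
    refine Prod.ext ?_ (by simp [lift])
    exact hf.smul_last _ c _
  rw [inv_smul_eq_iff₀ hc]
  ext1 X
  ext1 x
  change circ _ _ _ X x - (-1 : ℤ) ^ (1 * p) • circ _ _ _ X x =
    c • (circ _ _ _ X x - (-1 : ℤ) ^ (1 * p) • circ _ _ _ X x)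
  rw [circ_ofNary_left, circ_ofNary_right, circ_ofNary_left, circ_ofNary_right]
  -- Each term contains the operation once: outermost in one composition, inside an argument of `f`
  -- in the other, where linearity of the cochain is needed.
  simp only [hblock, hlast, smul_sub, smul_add, smul_sum, smul_ite, smul_zero, smul_comm c]

/-- Inserting `f` into the twisted bracket yields the two sums with `ρ_T`. Inserting the bracket
into `f` yields the other two, where the minus sign of the commutator turns `(-1)^j` into `(-1)^(j +
1)`. -/
theorem lift_coboundary_eq (hr : 1 ≤ r) (μ : g [⋀^Fin (r + 1)]→ₗ[K] g)
    (ρ : g [⋀^Fin r]→ₗ[K] Module.End K V) (T : V →ₗ[K] g) {p : ℕ} (f : Func r p V g) :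
    lift (coboundary (bracketT ρ T) (rhoT μ ρ T) f) = (-1 : ℤ) ^ p •
      gradedBracket (add_comm 1 p) (ofNary (twistedBracket μ ρ T)) (lift f) := by
  have hsign : ∀ a : ℕ, (-1 : ℤ) ^ a * (-1) ^ a = 1 := by
    intro a
    rw [← pow_add, Even.neg_one_pow ⟨a, rfl⟩]
  ext1 X
  ext1 x
  change _ = (-1 : ℤ) ^ p • (circ _ _ _ X x - (-1 : ℤ) ^ (1 * p) • circ _ _ _ X x)
  rw [circ_ofNary_left, circ_ofNary_right]
  refine Prod.ext ?_ ?_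
  · have hact : ∀ (Y : Fin r → g × V) (i : Fin r) (x₀ : g) (y : g × V),
        (twistedBracket μ ρ T (Fin.snoc (update Y i (x₀, 0)) y)).1 = (-1 : ℤ) ^ (r + (i : ℕ)) •
          rhoT μ ρ T (i.castSucc.removeNth
            (Fin.snoc (fun j => (Y j).2) y.2 : Fin (r + 1) → V)) x₀ := by
      intro Y i x₀ y
      rw [twistedBracket_snoc_update hr]
      rfl
    have hbr : ∀ (Y : Fin r → g × V) (y : g × V),
        (twistedBracket μ ρ T (Fin.snoc Y y)).2 =
          bracketT ρ T (Fin.snoc (fun j => (Y j).2) y.2) := by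
      intro Y y
      rw [twistedBracket_apply hr]
      refine congrArg (bracketT ρ T) ?_
      ext i
      refine Fin.lastCases ?_ (fun i => ?_) i <;> simp
    have hupd : ∀ (j : Fin (p + 1)) (k : Fin p) (i : Fin r) (w : g × V), j ≤ k.castSucc →
        (fun a b => (update (j.removeNth X) k (update (X k.succ) i w) a b).2) =
          j.removeNth (update (fun a b => (X a b).2) k.succ
            (update (fun b => (X k.succ b).2) i w.2)) := by
      intro j k i w hjk
      have hs : j.succAbove k = k.succ := Fin.succAbove_of_le_castSucc _ _ hjk
      ext a b
      by_cases ha : a = k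
      · subst ha
        by_cases hb : b = i
        · subst hb; simp [Fin.removeNth, hs]
        · simp [Fin.removeNth, hs, hb]
      · have : j.succAbove a ≠ k.succ := fun h => ha (Fin.succAbove_right_injective (h.trans hs.symm))
        simp [Fin.removeNth, ha, this]
    simp only [one_mul, smul_sub, smul_add, smul_smul, hsign, one_smul, Prod.fst_sub, Prod.fst_add,
      Prod.smul_fst, Prod.fst_sum]
    change coboundary _ _ f (fun a b => (X a b).2) x.2 = _
    rw [coboundary, ← sub_eq_zero]
    -- The block `k = 0` has no predecessor `j`, so the sum is reindexed by `k.succ`, with `j <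
    -- k.succ` equivalent to `j ≤ k.castSucc`.
    have hC : ∀ j : Fin (p + 1), (∑ k : Fin (p + 1), if j < k then
        (-1 : ℤ) ^ ((j : ℕ) + 1) • ∑ i : Fin r,
          f (j.removeNth (update (fun a b => (X a b).2) k (update (fun b => (X k b).2) i
            (bracketT ρ T (Fin.snoc (fun b => (X j b).2) (X k i).2))))) x.2
        else 0) =
        -∑ k : Fin p, (if j ≤ k.castSucc then
          (-1 : ℤ) ^ (j : ℕ) • ∑ i : Fin r, lift f (update (j.removeNth X) k
            (update (X k.succ) i (twistedBracket μ ρ T (Fin.snoc (X j) (X k.succ i))))) x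
          else 0).1 := by
      intro j
      rw [Fin.sum_univ_succ, if_neg (Fin.not_lt_zero j), zero_add, ← sum_neg_distrib]
      refine sum_congr rfl fun k _ => ?_
      by_cases hjk : j ≤ k.castSucc
      · rw [if_pos hjk, if_pos (Fin.le_castSucc_iff.1 hjk), pow_succ, mul_neg_one, neg_smul,
          Prod.smul_fst, Prod.fst_sum]
        refine congrArg (fun y => -((-1 : ℤ) ^ (j : ℕ) • y)) (sum_congr rfl fun i _ => ?_)
        simp only [lift]
        rw [hupd j k i _ hjk, hbr]
      · rw [if_neg hjk, if_neg fun h => hjk (Fin.le_castSucc_iff.2 h), Prod.fst_zero, neg_zero]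
    have hD : ∀ j : Fin (p + 1), (-1 : ℤ) ^ ((j : ℕ) + 1) •
        f (j.removeNth fun a b => (X a b).2)
          (bracketT ρ T (Fin.snoc (fun b => (X j b).2) x.2)) =
        -((-1 : ℤ) ^ (j : ℕ) •
          (lift f (j.removeNth X) (twistedBracket μ ρ T (Fin.snoc (X j) x))).1) := by
      intro j
      rw [pow_succ, mul_neg_one, neg_smul, ← hbr]
      rfl
    have hB : ∀ j : Fin (p + 1), (twistedBracket μ ρ T
        (Fin.snoc (X j) (lift f (j.removeNth X) x))).1 =
        rhoT μ ρ T (fun b => (X j b).2) (f (j.removeNth fun a b => (X a b).2) x.2) := by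
      intro j
      rw [lift, twistedBracket_snoc hr]
      rfl
    have hA : ∀ i : Fin r, (twistedBracket μ ρ T (Fin.snoc (update (X (Fin.last p)) i
        (lift f (fun a => X a.castSucc) (X (Fin.last p) i))) x)).1 =
        (-1 : ℤ) ^ (r + (i : ℕ)) • rhoT μ ρ T (i.castSucc.removeNth
          (Fin.snoc (fun b => (X (Fin.last p) b).2) x.2 : Fin (r + 1) → V))
            (f (fun a b => (X a.castSucc b).2) (X (Fin.last p) i).2) := by
      intro i
      rw [lift, hact]
    beta_reduce
    rw [sum_congr rfl fun j _ => hC j]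
    simp only [hD, hB, hA, sum_neg_distrib, smul_sum, smul_smul, ← pow_add]
    have hexp : ∀ i : Fin r, p + (r + (i : ℕ)) = r + p + (i : ℕ) := fun i => by omega
    simp only [hexp]
    abel
  -- The `V`-component vanishes: values of `lift f` lie in `g`, and the twisted bracket lies in `g`
  -- once one entry does.
  · have hact : ∀ i : Fin r, (twistedBracket μ ρ T (Fin.snoc (update (X (Fin.last p)) i
        (lift f (fun a => X a.castSucc) (X (Fin.last p) i))) x)).2 = 0 := by
      intro i
      rw [lift, twistedBracket_snoc_update hr, Prod.smul_snd, smul_zero]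
    have hlast : ∀ j : Fin (p + 1), (twistedBracket μ ρ T
        (Fin.snoc (X j) (lift f (j.removeNth X) x))).2 = 0 := by
      intro j
      rw [lift, twistedBracket_snoc hr]
    have hite : ∀ (c : Prop) [Decidable c] (w : g × V), w.2 = 0 →
        (if c then w else 0).2 = 0 := by
      intro c _ w hw
      split_ifs <;> simp [hw]
    have hlift : ∀ (Y : Fin p → Fin r → g × V) (y : g × V), (lift f Y y).2 = 0 := fun _ _ => rfl
    simp only [Prod.smul_snd, Prod.snd_sub, Prod.snd_add, Prod.snd_sum, hact, hlast, hlift,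
      sum_const_zero, smul_zero, add_zero, zero_sub]
    refine (smul_eq_zero_of_right _ (neg_eq_zero.2 (smul_eq_zero_of_right _
      (sum_eq_zero fun j _ => sum_eq_zero fun k _ => hite _ _ ?_)))).symm
    rw [Prod.smul_snd, Prod.snd_sum, sum_eq_zero fun i _ => hlift _ _, smul_zero]

end Main

end NLie

theorem mainTheorem5 {K g V : Type*} [Field K] [CharZero K]
    [AddCommGroup g] [Module K g] [AddCommGroup V] [Module K V]
    (r : ℕ) (hr : 1 ≤ r)
    (μ : g [⋀^Fin (r + 1)]→ₗ[K] g) (hμ : NLie.IsNLieBracket μ)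
    (ρ : g [⋀^Fin r]→ₗ[K] Module.End K V) (hρ : NLie.IsRepresentation μ ρ)
    (T : V →ₗ[K] g) (hT : NLie.IsRelativeRotaBaxter μ ρ T)
    (p : ℕ) (f : NLie.Func r p V g) (hf : f ∈ NLie.cochains K V g r p) :
    NLie.lift (NLie.coboundary (NLie.bracketT ρ T) (NLie.rhoT μ ρ T) f) =
      (-1 : ℤ) ^ p • NLie.l1T μ ρ T f := by
  rw [NLie.lift_coboundary_eq hr, NLie.l1T_eq hr,
    NLie.inv_smul_gradedBracket_ofNary_smul (Nat.cast_ne_zero.2 r.factorial_ne_zero) _ hf]
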